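/- Fix an integer $b\ge 2$. For $u\in[0,1)$ let $D_1,D_2,\dots\in\{0,\dots,b-1\}$ be its base-$b$ digits and $u_m=\sum_{t=1}^m D_t b^{-t}$ its truncation to $m$ digits. For $1\le j\le b-1$ put $$\bar Z_j=\frac1m\sum_{t=1}^m e^{2\pi i\, j b^{t-1}u_m},\qquad T=2m\sum_{j=1}^{b-1}|\bar Z_j|^2 .$$ Let $\theta^{(c)}_{j,t},\theta^{(s)}_{j,t}$ ($1\le j\le b-1$, $t\ge1$) be real numbers, let $$H_m(u)=\sum_{t=1}^m\sum_{j=1}^{b-1}\left[\theta^{(c)}_{j,t}\cos(2\pi j b^{t-1}u)+\theta^{(s)}_{j,t}\sin(2\pi j b^{t-1}u)\right],$$ and let $P_m$ be the probability measure on $[0,1]$ whose density with respect to the uniform distribution is $$\frac{\exp\{m^{-1/2}H_m(u)\}}{\int_0^1\exp\{m^{-1/2}H_m(v)\}\,dv}.$$ Assume that there is $M<\infty$ with $|\theta^{(c)}_{j,t}|,|\theta^{(s)}_{j,t}|\le M$ for all $j,t$, and that for each $j$ $$\frac1m\sum_{t=1}^m\theta^{(c)}_{j,t}\to\theta^{(c)}_j,\qquad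 \frac1m\sum_{t=1}^m\theta^{(s)}_{j,t}\to\theta^{(s)}_j\qquad(m\to\infty).$$ Then, for $u$ distributed according to $P_m$, as $m\to\infty$, $$(\sqrt m\,\bar Z_1,\dots,\sqrt m\,\bar Z_{b-1})\xrightarrow{d}\mathcal{CN}_{b-1}(\delta,I_{b-1}),\qquad \delta_j=\tfrac12\{\theta^{(c)}_j+i\,\theta^{(s)}_j\},$$ where $\mathcal{CN}_{b-1}(\delta,I_{b-1})$ is the law of a vector in $\mathbb C^{b-1}$ whose $2(b-1)$ real and imaginary parts are independent and distributed as $N(\operatorname{Re}\delta_j,\frac12)$ and $N(\operatorname{Im}\delta_j,\frac12)$. Hence $T$ converges in distribution to the noncentral chi-square law $\chi'^2_{2(b-1)}(\lambda)$ with $2(b-1)$ degrees of freedom and noncentrality $$\lambda=2\sum_{j=1}^{b-1}|\delta_j|^2=\frac12\sum_{j=1}^{b-1}\left\{(\theta^{(c)}_j)^2+(\theta^{(s)}_j)^2\right\}.$$ -/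

import Mathlib

open MeasureTheory ProbabilityTheory Filter
open scoped Topology

noncomputable section

namespace LacunaryTest

/-- The lacunary frequency `k_{j,t} = j b^{t-1}` for `t ≥ 1`. The harmonic orders `1, …, b - 1` are
indexed by `Fin (b - 1)`: the element `j : Fin (b - 1)` stands for the order `j + 1`. -/
def freq (b : ℕ) (j : Fin (b - 1)) (t : ℕ) : ℕ :=
  ((j : ℕ) + 1) * b ^ (t - 1)

/-- The base-`b` truncation `u_m = ∑_{t=1}^m D_t / b^t` of `u ∈ [0, 1)`, where `D_1, D_2, …` are the
base-`b` digits of `u` (`Real.digits u b i` is the digit `D_{i+1}`). -/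
def trunc (b : ℕ) [NeZero b] (m : ℕ) (u : ℝ) : ℝ :=
  ∑ t ∈ Finset.range m, ((Real.digits u b t : ℕ) : ℝ) / (b : ℝ) ^ (t + 1)

/-- The harmonic component `Z_{j,t} = exp(2 π i k_{j,t} u_m)`. -/
def harmonic (b : ℕ) [NeZero b] (m : ℕ) (j : Fin (b - 1)) (t : ℕ) (u : ℝ) : ℂ :=
  Complex.exp (2 * (Real.pi : ℂ) * Complex.I * (freq b j t : ℂ) * (trunc b m u : ℂ))

/-- The averaged harmonic `Z̄_j = m⁻¹ ∑_{t=1}^m Z_{j,t}`. -/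
def harmonicMean (b : ℕ) [NeZero b] (m : ℕ) (j : Fin (b - 1)) (u : ℝ) : ℂ :=
  (m : ℂ)⁻¹ * ∑ t ∈ Finset.Icc 1 m, harmonic b m j t u

/-- The normalized harmonic vector `(√m Z̄_1, …, √m Z̄_{b-1})`. -/
def harmonicVector (b : ℕ) [NeZero b] (m : ℕ) (u : ℝ) : Fin (b - 1) → ℂ :=
  fun j => ((√(m : ℝ) : ℝ) : ℂ) * harmonicMean b m j u

/-- The test statistic `T = 2 m ∑_j |Z̄_j|²`. -/
def testStat (b : ℕ) [NeZero b] (m : ℕ) (u : ℝ) : ℝ :=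
  2 * (m : ℝ) * ∑ j, ‖harmonicMean b m j u‖ ^ 2

/-- The lacunary trigonometric polynomial
`H_m(u) = ∑_{t=1}^m ∑_j (θc_{j,t} cos(2 π k_{j,t} u) + θs_{j,t} sin(2 π k_{j,t} u))`. -/
def lacunaryPoly (b : ℕ) (θc θs : Fin (b - 1) → ℕ → ℝ) (m : ℕ) (u : ℝ) : ℝ :=
  ∑ t ∈ Finset.Icc 1 m, ∑ j,
    (θc j t * Real.cos (2 * Real.pi * (freq b j t : ℝ) * u)
      + θs j t * Real.sin (2 * Real.pi * (freq b j t : ℝ) * u))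

/-- The uniform distribution `P_0` on `[0, 1]`. -/
def unifLaw : Measure ℝ := volume.restrict (Set.Icc 0 1)

instance : IsProbabilityMeasure unifLaw := by
  constructor
  simp [unifLaw]

/-- The local alternative `P_m`: the probability measure whose density with respect to `P_0` is
`exp(m^{-1/2} H_m(u)) / ∫ exp(m^{-1/2} H_m(v)) dP_0(v)`. -/
def altLaw (b : ℕ) (θc θs : Fin (b - 1) → ℕ → ℝ) (m : ℕ) : Measure ℝ :=
  unifLaw.tilted (fun u => (√(m : ℝ))⁻¹ * lacunaryPoly b θc θs m u)

instance (b : ℕ) (θc θs : Fin (b - 1) → ℕ → ℝ) (m : ℕ) :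
    IsProbabilityMeasure (altLaw b θc θs m) := by
  apply isProbabilityMeasure_tilted
  have hc : Continuous
      (fun u : ℝ => Real.exp ((√(m : ℝ))⁻¹ * lacunaryPoly b θc θs m u)) := by
    unfold lacunaryPoly
    fun_prop
  exact hc.continuousOn.integrableOn_compact isCompact_Icc

/-- The complex normal law on `ℂⁿ` with mean `δ` and identity covariance: independent coordinates,
the real and imaginary parts of the `j`-th one being independent `N(Re δ_j, 1/2)` and
`N(Im δ_j, 1/2)`. -/
def complexNormal {n : ℕ} (δ : Fin n → ℂ) : Measure (Fin n → ℂ) :=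
  Measure.pi fun j =>
    ((gaussianReal (δ j).re (1 / 2)).prod (gaussianReal (δ j).im (1 / 2))).map
      Complex.measurableEquivRealProd.symm

instance {n : ℕ} (δ : Fin n → ℂ) : IsProbabilityMeasure (complexNormal δ) := by
  have (j : Fin n) : IsProbabilityMeasure
      (((gaussianReal (δ j).re (1 / 2)).prod (gaussianReal (δ j).im (1 / 2))).map
        Complex.measurableEquivRealProd.symm) :=
    Measure.isProbabilityMeasure_map Complex.measurableEquivRealProd.symm.measurable.aemeasurable
  unfold complexNormal
  infer_instance

/-- The noncentral chi-square law with `k ≥ 1` degrees of freedom and noncentrality `l ≥ 0`: the law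
of `∑_i X_i²` for independent unit-variance normal variables `X_1, …, X_k` whose means have sum of
squares `l`. By rotation invariance only `l` matters; the mean vector taken here is
`(√l, 0, …, 0)`. -/
def noncentralChiSq (k : ℕ) (l : ℝ) : Measure ℝ :=
  (Measure.pi fun i : Fin k => gaussianReal (if (i : ℕ) = 0 then √l else 0) 1).map
    fun x => ∑ i, x i ^ 2

instance (k : ℕ) (l : ℝ) : IsProbabilityMeasure (noncentralChiSq k l) :=
  Measure.isProbabilityMeasure_map (Measurable.aemeasurable (by fun_prop))

end LacunaryTest

end

/-! The map x ↦ bx mod 1 preserves Lebesgue measure, and averaging over its b inverse branches, L =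
`branchAvg b`, is its transfer operator. A lacunary polynomial has the form Σ_{t<m} g_t(b^t u),
where g_t has frequencies ±1, …, ±(b-1). None of these is divisible by b, so L g_t = 0 and the
summands are reversed martingale differences. The conditional variance L(g_t²) is not constant, but
the frequencies of g_t² are below b² in absolute value, so a second L leaves only a constant 2 V_t.

Integrating exp(Σ g_t(b^t u)) amounts to iterating f ↦ L(f e^{g_t}) from f = 1. The iterates stay
close to exp(Σ V_s)(1 + w_t), where w_t is a small correction with L w_t = 0; this is
`norm_integral_exp_sum_sub_exp_le`. With sup |g_t| of order m^{-1/2} the error is O(m^{-1/2}), and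
the coefficients may be complex.

A characteristic function under P_m is therefore a quotient of two such integrals, with coefficients
θ + ia and θ. The exponents are averages of (θ + ia)²/4 and θ²/4, so they differ by iaθ/2 - a²/4:
the first term gives the mean δ, the second the variance 1/2. The common factor exp(avg θ²/4) need
not converge, but it is at least 1 and cancels (`tendsto_div_of_sub_mul_tendsto_zero`). Truncating u
moves the phase at level t by O(b^{t-m}), a geometric series, hence O(m^{-1/2}) after normalization.
The chi-square limit follows by continuous mapping and rotation invariance of the Gaussian. -/

namespace LacunaryTest

/-! ### The transfer operator of x ↦ bx mod 1. -/

/-- The average of `f` over the `b` preimages of `y` under `x ↦ b x` modulo `1`. -/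
noncomputable def branchAvg (b : ℕ) (f : ℝ → ℂ) (y : ℝ) : ℂ :=
  (b : ℂ)⁻¹ * ∑ k ∈ Finset.range b, f ((y + k) / b)

lemma continuous_branchAvg {b : ℕ} {f : ℝ → ℂ} (hf : Continuous f) :
    Continuous (branchAvg b f) := by
  unfold branchAvg
  fun_prop

lemma branchAvg_add (b : ℕ) (f g : ℝ → ℂ) (y : ℝ) :
    branchAvg b (fun x => f x + g x) y = branchAvg b f y + branchAvg b g y := by
  simp [branchAvg, Finset.sum_add_distrib, mul_add]

lemma branchAvg_sub (b : ℕ) (f g : ℝ → ℂ) (y : ℝ) :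
    branchAvg b (fun x => f x - g x) y = branchAvg b f y - branchAvg b g y := by
  simp [branchAvg, Finset.sum_sub_distrib, mul_sub]

lemma branchAvg_const_mul (b : ℕ) (c : ℂ) (f : ℝ → ℂ) (y : ℝ) :
    branchAvg b (fun x => c * f x) y = c * branchAvg b f y := by
  simp only [branchAvg, ← Finset.mul_sum]
  ring

lemma branchAvg_sum (b : ℕ) {ι : Type*} (s : Finset ι) (f : ι → ℝ → ℂ) (y : ℝ) :
    branchAvg b (fun x => ∑ i ∈ s, f i x) y = ∑ i ∈ s, branchAvg b (f i) y := by
  simp only [branchAvg, ← Finset.mul_sum]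
  rw [Finset.sum_comm]

lemma branchAvg_const {b : ℕ} (hb : b ≠ 0) (c : ℂ) (y : ℝ) :
    branchAvg b (fun _ => c) y = c := by
  have : (b : ℂ) ≠ 0 := by exact_mod_cast hb
  simp [branchAvg, this]

/-- On the branches x = (y + k)/b the second factor is h(y + k) = h(y), so it pulls out like a
measurable factor from a conditional expectation. -/
lemma branchAvg_mul_comp {b : ℕ} (hb : b ≠ 0) (f : ℝ → ℂ) {h : ℝ → ℂ}
    (hh : Function.Periodic h 1) (y : ℝ) :
    branchAvg b (fun x => f x * h (b * x)) y = branchAvg b f y * h y := by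
  have hb' : (b : ℝ) ≠ 0 := by exact_mod_cast hb
  simp only [branchAvg]
  rw [mul_assoc, Finset.sum_mul]
  congr 1
  refine Finset.sum_congr rfl fun k _ => ?_
  rw [mul_div_cancel₀ _ hb']
  congr 1
  simpa using hh.nat_mul k y

lemma norm_branchAvg_le_avg (b : ℕ) {f : ℝ → ℂ} {φ : ℝ → ℝ} (h : ∀ x, ‖f x‖ ≤ φ x) (y : ℝ) :
    ‖branchAvg b f y‖ ≤ (b : ℝ)⁻¹ * ∑ k ∈ Finset.range b, φ ((y + k) / b) := by
  rw [branchAvg, norm_mul, norm_inv, Complex.norm_natCast]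
  gcongr
  exact (norm_sum_le _ _).trans (Finset.sum_le_sum fun k _ => h _)

lemma norm_branchAvg_le {b : ℕ} (hb : b ≠ 0) {f : ℝ → ℂ} {C : ℝ} (h : ∀ x, ‖f x‖ ≤ C) (y : ℝ) :
    ‖branchAvg b f y‖ ≤ C := by
  have hb' : (b : ℝ) ≠ 0 := by exact_mod_cast hb
  refine (norm_branchAvg_le_avg b h y).trans (le_of_eq ?_)
  simp [hb']

/-- Invariance of Lebesgue measure: the k-th branch carries [0, 1] onto [k/b, (k+1)/b], and these
intervals tile [0, 1]. -/
lemma intervalIntegral_branchAvg {b : ℕ} (hb : b ≠ 0) {f : ℝ → ℂ} (hf : Continuous f) :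
    ∫ y in (0 : ℝ)..1, branchAvg b f y = ∫ x in (0 : ℝ)..1, f x := by
  have hb' : (b : ℝ) ≠ 0 := by exact_mod_cast hb
  have hbc : (b : ℂ) ≠ 0 := by exact_mod_cast hb
  simp only [branchAvg]
  rw [intervalIntegral.integral_const_mul,
    intervalIntegral.integral_finsetSum (f := fun (k : ℕ) (y : ℝ) => f ((y + k) / b))
      (fun k _ => Continuous.intervalIntegrable (by fun_prop) _ _)]
  have h1 (k : ℕ) : ∫ y in (0 : ℝ)..1, f ((y + k) / b)
      = (b : ℂ) * ∫ x in ((k : ℝ) / b)..((k + 1 : ℕ) : ℝ) / b, f x := by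
    have := intervalIntegral.integral_comp_div_add (a := 0) (b := 1) (f := f) hb' ((k : ℝ) / b)
    rw [show (fun y : ℝ => f ((y + k) / b)) = fun y => f (y / b + k / b) by
      ext y; rw [add_div], this]
    simp [add_div, add_comm]
  rw [Finset.sum_congr rfl fun k _ => h1 k, ← Finset.mul_sum,
    intervalIntegral.sum_integral_adjacent_intervals (a := fun k : ℕ => (k : ℝ) / b)
      (fun k _ => hf.intervalIntegrable _ _), inv_mul_cancel_left₀ hbc]
  simp [hb']

/-! ### Twisted iterates and the quantitative central limit estimate. -/

/-- The iterates `f_{t+1} = branchAvg (f_t exp g_t)`. -/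
noncomputable def transferIter (b : ℕ) (g : ℕ → ℝ → ℂ) (f : ℝ → ℂ) : ℕ → ℝ → ℂ
  | 0 => f
  | t + 1 => branchAvg b fun x => transferIter b g f t x * Complex.exp (g t x)

/-- Peels off the first twist instead of the last, which is the form needed for an induction that
changes the initial function. -/
lemma transferIter_succ' (b : ℕ) (g : ℕ → ℝ → ℂ) (f : ℝ → ℂ) (m : ℕ) :
    transferIter b g f (m + 1) = transferIter b (fun t => g (t + 1))
      (branchAvg b fun x => f x * Complex.exp (g 0 x)) m := by
  induction m with
  | zero => rfl
  | succ m ih => rw [transferIter, ih, transferIter]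

/-- Only the t = 0 factor is not a 1-periodic function of bu. Applying L under the integral absorbs
that factor into f and lowers every other power of b by one. -/
lemma integral_mul_exp_sum_eq {b : ℕ} (hb : b ≠ 0) (m : ℕ) (g : ℕ → ℝ → ℂ)
    (hg : ∀ t, Continuous (g t)) (hp : ∀ t, Function.Periodic (g t) 1)
    (f : ℝ → ℂ) (hf : Continuous f) :
    ∫ u in (0 : ℝ)..1, f u * Complex.exp (∑ t ∈ Finset.range m, g t ((b : ℝ) ^ t * u))
      = ∫ u in (0 : ℝ)..1, transferIter b g f m u := by
  induction m generalizing g f with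
  | zero => simp [transferIter]
  | succ m ih =>
    rw [transferIter_succ', ← ih _ (fun t => hg _) (fun t => hp _) _
      (continuous_branchAvg (by fun_prop))]
    have hper : Function.Periodic (fun u : ℝ =>
        Complex.exp (∑ t ∈ Finset.range m, g (t + 1) ((b : ℝ) ^ t * u))) 1 := by
      intro u
      simp only
      congr 1
      refine Finset.sum_congr rfl fun t _ => ?_
      have := (hp (t + 1)).nat_mul (b ^ t) ((b : ℝ) ^ t * u)
      rw [← this]
      congr 1
      push_cast
      ring
    simp_rw [← branchAvg_mul_comp hb (fun x => f x * Complex.exp (g 0 x)) hper]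
    rw [intervalIntegral_branchAvg hb (by fun_prop)]
    congr 1
    ext u
    rw [Finset.sum_range_succ', add_comm, Complex.exp_add, mul_assoc]
    simp [pow_succ, mul_assoc]

lemma continuous_transferIter {b : ℕ} {g : ℕ → ℝ → ℂ} (hg : ∀ t, Continuous (g t))
    {f : ℝ → ℂ} (hf : Continuous f) (m : ℕ) : Continuous (transferIter b g f m) := by
  induction m with
  | zero => exact hf
  | succ m ih => exact continuous_branchAvg (by fun_prop)

/-- The trivial growth factor e^κ would accumulate to e^{mκ}, unbounded for κ of order m^{-1/2}.
Since |e^g| ≤ 1 + Re g + κ² and Re g averages to 0, the growth per step is only e^{κ²}. -/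
lemma norm_branchAvg_mul_exp_le {b : ℕ} (hb : b ≠ 0) {g f : ℝ → ℂ} {κ C : ℝ} (hκ : κ ≤ 1)
    (hC : 0 ≤ C) (hgκ : ∀ x, ‖g x‖ ≤ κ) (hf : ∀ x, ‖f x‖ ≤ C) (y : ℝ) (h0 : branchAvg b g y = 0) :
    ‖branchAvg b (fun x => f x * Complex.exp (g x)) y‖ ≤ C * Real.exp (κ ^ 2) := by
  have hb' : (b : ℝ) ≠ 0 := by exact_mod_cast hb
  have hκ0 : 0 ≤ κ := (norm_nonneg _).trans (hgκ 0)
  have hbd (x : ℝ) : ‖f x * Complex.exp (g x)‖ ≤ C * (1 + (g x).re + κ ^ 2) := by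
    rw [norm_mul, Complex.norm_exp]
    have hre : |(g x).re| ≤ κ := (Complex.abs_re_le_norm _).trans (hgκ x)
    have h1 := Real.abs_exp_sub_one_sub_id_le (hre.trans hκ)
    have h2 := (abs_le.mp h1).2
    have h3 : (g x).re ^ 2 ≤ κ ^ 2 := sq_le_sq' (abs_le.mp hre).1 (abs_le.mp hre).2
    exact mul_le_mul (hf x) (by linarith) (Real.exp_pos _).le hC
  refine (norm_branchAvg_le_avg b hbd y).trans ?_
  have hre0 : (b : ℝ)⁻¹ * ∑ k ∈ Finset.range b, (g ((y + k) / b)).re = 0 := by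
    have := congrArg Complex.re h0
    rw [branchAvg, show ((b : ℂ)⁻¹) = (((b : ℝ)⁻¹ : ℝ) : ℂ) by push_cast; rfl,
      Complex.re_ofReal_mul, Complex.re_sum] at this
    simpa using this
  calc (b : ℝ)⁻¹ * ∑ k ∈ Finset.range b, C * (1 + (g ((y + k) / b)).re + κ ^ 2)
      = C * ((b : ℝ)⁻¹ * b + (b : ℝ)⁻¹ * ∑ k ∈ Finset.range b, (g ((y + k) / b)).re
        + (b : ℝ)⁻¹ * b * κ ^ 2) := by
        rw [← Finset.mul_sum]
        simp only [Finset.sum_add_distrib, Finset.sum_const, Finset.card_range, nsmul_eq_mul]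
        ring
    _ = C * (κ ^ 2 + 1) := by rw [hre0, inv_mul_cancel₀ hb']; ring
    _ ≤ _ := by gcongr; exact Real.add_one_le_exp _

lemma norm_exp_sub_one_sub_id_sub_half_sq_le {z : ℂ} (hz : ‖z‖ ≤ 1) :
    ‖Complex.exp z - 1 - z - z ^ 2 / 2‖ ≤ ‖z‖ ^ 3 := by
  have h := Complex.exp_bound hz (n := 3) (by norm_num)
  simp only [Finset.sum_range_succ, Finset.sum_range_zero] at h
  norm_num [Nat.factorial] at h
  have h3 : 0 ≤ ‖z‖ ^ 3 := by positivity
  calc ‖Complex.exp z - 1 - z - z ^ 2 / 2‖ = ‖Complex.exp z - (1 + z + z ^ 2 / 2)‖ := by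
        congr 1; ring
    _ ≤ ‖z‖ ^ 3 * (2 / 9) := by simpa using h
    _ ≤ _ := by linarith

/-- Second-order expansion: (1 + w)e^g = 1 + w + g + g²/2 + ρ with ρ = O(κ³). After averaging, w and
g vanish and g²/2 becomes V + w', so the result agrees with e^V (1 + w') up to O(κ³). The constant 6
is 3 from ρ, 1 from e^V - 1 - V and 2 from (e^V - 1)w'. -/
lemma norm_branchAvg_step_le {b : ℕ} (hb : b ≠ 0) {g w : ℝ → ℂ} {V : ℂ} {κ : ℝ} (hκ : κ ≤ 1)
    (hg : ∀ x, ‖g x‖ ≤ κ) (hw : ∀ x, ‖w x‖ ≤ κ ^ 2) (hV : ‖V‖ ≤ κ ^ 2)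
    (hg0 : ∀ y, branchAvg b g y = 0) (hw0 : ∀ y, branchAvg b w y = 0) {w' : ℝ → ℂ}
    (hw' : ∀ x, ‖w' x‖ ≤ κ ^ 2)
    (hg2 : ∀ y, branchAvg b (fun x => g x ^ 2) y = 2 * (V + w' y)) (y : ℝ) :
    ‖branchAvg b (fun x => (1 + w x) * Complex.exp (g x)) y - Complex.exp V * (1 + w' y)‖
      ≤ 6 * κ ^ 3 := by
  have hκ0 : 0 ≤ κ := (norm_nonneg _).trans (hg 0)
  have hκ2 : κ ^ 2 ≤ 1 := pow_le_one₀ hκ0 hκ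
  set ρ : ℝ → ℂ := fun x => w x * (Complex.exp (g x) - 1)
    + (Complex.exp (g x) - 1 - g x - g x ^ 2 / 2) with hρ
  have hρb (x : ℝ) : ‖ρ x‖ ≤ 3 * κ ^ 3 := by
    have h1 : ‖Complex.exp (g x) - 1‖ ≤ 2 * κ :=
      (Complex.norm_exp_sub_one_le ((hg x).trans hκ)).trans (by gcongr; exact hg x)
    have h2 : ‖Complex.exp (g x) - 1 - g x - g x ^ 2 / 2‖ ≤ κ ^ 3 :=
      (norm_exp_sub_one_sub_id_sub_half_sq_le ((hg x).trans hκ)).trans (by gcongr; exact hg x)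
    calc ‖ρ x‖ ≤ ‖w x‖ * ‖Complex.exp (g x) - 1‖ + κ ^ 3 := by
          rw [hρ, ← norm_mul]; exact (norm_add_le _ _).trans (by gcongr)
      _ ≤ κ ^ 2 * (2 * κ) + κ ^ 3 := by gcongr; exact hw x
      _ = _ := by ring
  have hexp : branchAvg b (fun x => (1 + w x) * Complex.exp (g x)) y
      = 1 + (V + w' y) + branchAvg b ρ y := by
    have : (fun x => (1 + w x) * Complex.exp (g x))
        = fun x => ((1 + w x) + (g x + (1 / 2 : ℂ) * g x ^ 2)) + ρ x := by
      ext x; simp only [hρ]; ring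
    rw [this, branchAvg_add, branchAvg_add, branchAvg_add, branchAvg_add, branchAvg_const_mul,
      branchAvg_const hb, hg0, hw0, hg2]
    ring
  have hVe := Complex.norm_exp_sub_one_sub_id_le (hV.trans hκ2)
  have hV1 := Complex.norm_exp_sub_one_le (hV.trans hκ2)
  have hdec : branchAvg b (fun x => (1 + w x) * Complex.exp (g x)) y - Complex.exp V * (1 + w' y)
      = branchAvg b ρ y - (Complex.exp V - 1 - V) - (Complex.exp V - 1) * w' y := by
    rw [hexp]; ring
  rw [hdec]
  have h4 : κ ^ 4 ≤ κ ^ 3 := pow_le_pow_of_le_one hκ0 hκ (by norm_num)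
  calc _ ≤ ‖branchAvg b ρ y‖ + ‖Complex.exp V - 1 - V‖ + ‖Complex.exp V - 1‖ * ‖w' y‖ := by
        rw [← norm_mul]
        exact (norm_sub_le _ _).trans (by gcongr; exact norm_sub_le _ _)
    _ ≤ 3 * κ ^ 3 + (κ ^ 2) ^ 2 + 2 * κ ^ 2 * κ ^ 2 := by
        gcongr
        · exact norm_branchAvg_le hb hρb y
        · exact hVe.trans (by gcongr)
        · exact hV1.trans (by gcongr)
        · exact hw' y
    _ ≤ _ := by nlinarith

/-- A quantitative central limit estimate for the Laplace transform of a complex combination of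
reversed martingale differences `g_t(b^t u)`, `u` uniform on `[0, 1]`. -/
theorem norm_integral_exp_sum_sub_exp_le {b : ℕ} (hb : b ≠ 0) {g : ℕ → ℝ → ℂ} {V : ℕ → ℂ}
    {κ : ℝ} (hκ : κ ≤ 1) (hc : ∀ t, Continuous (g t)) (hp : ∀ t, Function.Periodic (g t) 1)
    (hgκ : ∀ t x, ‖g t x‖ ≤ κ) (hg0 : ∀ t y, branchAvg b (g t) y = 0)
    (hg2 : ∀ t y, branchAvg b (branchAvg b fun x => g t x ^ 2) y = 2 * V t) (m : ℕ) :
    ‖(∫ u in (0 : ℝ)..1, Complex.exp (∑ t ∈ Finset.range m, g t ((b : ℝ) ^ t * u)))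
        - Complex.exp (∑ t ∈ Finset.range m, V t)‖
      ≤ (6 * m * κ ^ 3 + κ ^ 2) * Real.exp (m * κ ^ 2) := by
  have hκ0 : 0 ≤ κ := (norm_nonneg _).trans (hgκ 0 0)
  have hsq (t : ℕ) (x : ℝ) : ‖branchAvg b (fun x => g t x ^ 2) x‖ ≤ κ ^ 2 := by
    refine norm_branchAvg_le hb (fun z => ?_) x
    rw [norm_pow]
    gcongr
    exact hgκ t z
  have hV (t : ℕ) : ‖V t‖ ≤ κ ^ 2 / 2 := by
    have h1 : ‖2 * V t‖ ≤ κ ^ 2 := by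
      rw [← hg2 t 0]
      exact norm_branchAvg_le hb (hsq t) 0
    rw [norm_mul, Complex.norm_ofNat] at h1
    linarith
  have hV' (t : ℕ) : ‖V t‖ ≤ κ ^ 2 := (hV t).trans (by nlinarith [sq_nonneg κ])
  -- the centred conditional variance, killed by one further averaging
  let w : ℕ → ℝ → ℂ := fun t => Nat.casesOn t (fun _ => 0)
    fun t x => (1 / 2 : ℂ) * branchAvg b (fun z => g t z ^ 2) x - V t
  have hw (t : ℕ) (x : ℝ) : ‖w t x‖ ≤ κ ^ 2 := by
    cases t with
    | zero => simpa [w] using sq_nonneg κ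
    | succ t =>
      refine (norm_sub_le _ _).trans ?_
      rw [norm_mul]
      have := hsq t x
      have := hV t
      norm_num
      linarith
  have hw0 (t : ℕ) (y : ℝ) : branchAvg b (w t) y = 0 := by
    cases t with
    | zero => simp [w, branchAvg]
    | succ t =>
      simp only [w]
      rw [branchAvg_sub, branchAvg_const_mul, branchAvg_const hb, hg2]
      ring
  have hwc (t : ℕ) : Continuous (w t) := by
    cases t with
    | zero => exact continuous_const
    | succ t =>
      have := continuous_branchAvg (b := b) (f := fun z => g t z ^ 2) (by fun_prop)
      simp only [w]
      fun_prop
  have hgw (t : ℕ) (y : ℝ) : branchAvg b (fun x => g t x ^ 2) y = 2 * (V t + w (t + 1) y) := by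
    simp only [w]
    ring
  have hq (t : ℕ) : ‖Complex.exp (∑ s ∈ Finset.range t, V s)‖ ≤ Real.exp (t * κ ^ 2) := by
    refine (Complex.norm_exp_le_exp_norm _).trans (Real.exp_le_exp.mpr ?_)
    refine (norm_sum_le _ _).trans ((Finset.sum_le_sum fun s _ => hV' s).trans ?_)
    simp
  -- Each step multiplies the old error by at most e^{κ²} and adds a new one of size 6κ³ times the
  -- main factor. The choice w 0 = 0 makes the initial error zero.
  have key (t : ℕ) (y : ℝ) : ‖transferIter b g (fun _ => 1) t y
      - Complex.exp (∑ s ∈ Finset.range t, V s) * (1 + w t y)‖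
        ≤ 6 * t * κ ^ 3 * Real.exp (t * κ ^ 2) := by
    induction t generalizing y with
    | zero => simp [transferIter, w]
    | succ t ih =>
      set q := Complex.exp (∑ s ∈ Finset.range t, V s) with hqdef
      have hadd : branchAvg b (fun x => transferIter b g (fun _ => 1) t x * Complex.exp (g t x)) y
          = branchAvg b (fun x => (transferIter b g (fun _ => 1) t x - q * (1 + w t x))
              * Complex.exp (g t x)) y
            + q * branchAvg b (fun x => (1 + w t x) * Complex.exp (g t x)) y := by
        rw [← branchAvg_const_mul, ← branchAvg_add]
        congr 1
        ext x
        ring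
      have hdec : transferIter b g (fun _ => 1) (t + 1) y
          - Complex.exp (∑ s ∈ Finset.range (t + 1), V s) * (1 + w (t + 1) y)
          = branchAvg b (fun x => (transferIter b g (fun _ => 1) t x - q * (1 + w t x))
              * Complex.exp (g t x)) y
            + q * (branchAvg b (fun x => (1 + w t x) * Complex.exp (g t x)) y
              - Complex.exp (V t) * (1 + w (t + 1) y)) := by
        rw [transferIter, hadd, Finset.sum_range_succ, Complex.exp_add, ← hqdef]
        ring
      rw [hdec]
      have h1 := norm_branchAvg_mul_exp_le hb hκ (by positivity) (hgκ t) ih y (hg0 t y)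
      have h2 := norm_branchAvg_step_le hb hκ (hgκ t) (hw t) (hV' t) (hg0 t) (hw0 t)
        (hw (t + 1)) (hgw t) y
      have h3 : Real.exp (t * κ ^ 2) ≤ Real.exp (((t + 1 : ℕ) : ℝ) * κ ^ 2) := by
        gcongr
        simp
      have h4 : Real.exp (t * κ ^ 2) * Real.exp (κ ^ 2)
          = Real.exp (((t + 1 : ℕ) : ℝ) * κ ^ 2) := by
        rw [← Real.exp_add]
        congr 1
        push_cast
        ring
      calc _ ≤ 6 * t * κ ^ 3 * Real.exp (t * κ ^ 2) * Real.exp (κ ^ 2)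
            + Real.exp (((t + 1 : ℕ) : ℝ) * κ ^ 2) * (6 * κ ^ 3) := by
            refine (norm_add_le _ _).trans (add_le_add h1 ?_)
            rw [norm_mul]
            gcongr
            exact (hq t).trans h3
        _ = _ := by
            rw [mul_assoc _ (Real.exp _) (Real.exp _), h4]
            push_cast
            ring
  have hint := integral_mul_exp_sum_eq hb m g hc hp (fun _ => 1) continuous_const
  simp only [one_mul] at hint
  rw [hint]
  set q := Complex.exp (∑ s ∈ Finset.range m, V s) with hqdef
  have hcont := continuous_transferIter (b := b) hc (f := fun _ => (1 : ℂ)) continuous_const m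
  have hsub : (∫ u in (0 : ℝ)..1, transferIter b g (fun _ => 1) m u) - q
      = ∫ u in (0 : ℝ)..1, (transferIter b g (fun _ => 1) m u - q) := by
    rw [intervalIntegral.integral_sub (hcont.intervalIntegrable _ _)
      (continuous_const.intervalIntegrable _ _)]
    simp
  rw [hsub]
  refine (intervalIntegral.norm_integral_le_of_norm_le_const
    (C := (6 * m * κ ^ 3 + κ ^ 2) * Real.exp (m * κ ^ 2)) fun u _ => ?_).trans (by simp)
  calc ‖transferIter b g (fun _ => 1) m u - q‖
      = ‖(transferIter b g (fun _ => 1) m u - q * (1 + w m u)) + q * w m u‖ := by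
        congr 1; ring
    _ ≤ 6 * m * κ ^ 3 * Real.exp (m * κ ^ 2) + Real.exp (m * κ ^ 2) * κ ^ 2 := by
        refine (norm_add_le _ _).trans (add_le_add (key m u) ?_)
        rw [norm_mul]
        gcongr
        · exact hq m
        · exact hw m u
    _ = _ := by ring

/-! ### Fourier analysis of the transfer operator. -/

/-- The character `x ↦ exp(2 π i n x)`. -/
noncomputable def expi (n : ℤ) (x : ℝ) : ℂ :=
  Complex.exp (2 * Real.pi * Complex.I * n * x)

lemma expi_add (n k : ℤ) (x : ℝ) : expi (n + k) x = expi n x * expi k x := by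
  rw [expi, expi, expi, ← Complex.exp_add]
  congr 1
  push_cast
  ring

lemma expi_zero (x : ℝ) : expi 0 x = 1 := by simp [expi]

lemma periodic_expi (n : ℤ) : Function.Periodic (expi n) 1 := by
  intro x
  rw [expi, expi, Complex.exp_eq_exp_iff_exists_int]
  exact ⟨n, by push_cast; ring⟩

lemma branchAvg_expi_mul {b : ℕ} (hb : b ≠ 0) (k : ℤ) (y : ℝ) :
    branchAvg b (expi (b * k)) y = expi k y := by
  have h := branchAvg_mul_comp hb (fun _ => 1) (periodic_expi k) y
  rw [branchAvg_const hb, one_mul] at h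
  rw [← h]
  congr 1
  ext x
  rw [one_mul, expi, expi]
  congr 1
  push_cast
  ring

/-- Over the b branches the character runs through a full geometric sum of a b-th root of unity,
which is different from 1 because b does not divide n. -/
lemma branchAvg_expi_of_not_dvd {b : ℕ} (hb : b ≠ 0) {n : ℤ} (hn : ¬ (b : ℤ) ∣ n) (y : ℝ) :
    branchAvg b (expi n) y = 0 := by
  have hbc : (b : ℂ) ≠ 0 := by exact_mod_cast hb
  set ζ : ℂ := Complex.exp (2 * Real.pi * Complex.I * n / b) with hζ
  have hterm (k : ℕ) : expi n ((y + k) / b) = expi n (y / b) * ζ ^ k := by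
    rw [hζ, ← Complex.exp_nat_mul, expi, expi, ← Complex.exp_add]
    congr 1
    push_cast
    field_simp
  have hpow : ζ ^ b = 1 := by
    rw [hζ, ← Complex.exp_nat_mul, Complex.exp_eq_one_iff]
    exact ⟨n, by field_simp⟩
  have hne : ζ ≠ 1 := by
    rw [hζ, Ne, Complex.exp_eq_one_iff]
    rintro ⟨k, hk⟩
    refine hn ⟨k, ?_⟩
    have hpi := Complex.two_pi_I_ne_zero
    have : (n : ℂ) = b * k := by
      field_simp at hk
      have h2 : (2 * (Real.pi : ℂ) * Complex.I) * n = (2 * Real.pi * Complex.I) * (b * k) := by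
        linear_combination (2 * (Real.pi : ℂ) * Complex.I) * hk
      exact mul_left_cancel₀ hpi h2
    exact_mod_cast this
  have hgeom : ∑ k ∈ Finset.range b, ζ ^ k = 0 := by
    rw [geom_sum_eq hne, hpow]
    simp
  simp only [branchAvg, hterm]
  rw [← Finset.mul_sum, hgeom]
  simp

/-- A frequency surviving the first average is bk with |k| < b, and the second average kills every
such k except 0. -/
lemma branchAvg_branchAvg_expi {b : ℕ} (hb : b ≠ 0) {n : ℤ} (hn : |n| < b * b) (y : ℝ) :
    branchAvg b (branchAvg b (expi n)) y = if n = 0 then 1 else 0 := by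
  have hb0 : (0 : ℤ) < b := by exact_mod_cast Nat.pos_of_ne_zero hb
  by_cases hd : (b : ℤ) ∣ n
  · obtain ⟨k, rfl⟩ := hd
    rw [show branchAvg b (expi (b * k)) = expi k from funext (branchAvg_expi_mul hb k)]
    rw [abs_mul, abs_of_pos hb0] at hn
    have hk : |k| < b := lt_of_mul_lt_mul_left hn hb0.le
    by_cases hk0 : k = 0
    · subst hk0
      simp only [mul_zero, if_true]
      rw [show expi 0 = fun _ => 1 from funext expi_zero, branchAvg_const hb]
    · rw [branchAvg_expi_of_not_dvd hb (fun h => hk0 (Int.eq_zero_of_abs_lt_dvd h hk)),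
        if_neg (mul_ne_zero hb0.ne' hk0)]
  · rw [show branchAvg b (expi n) = fun _ => 0 from funext (branchAvg_expi_of_not_dvd hb hd),
      branchAvg_const hb, if_neg]
    rintro rfl
    exact hd (dvd_zero _)

/-- The trigonometric polynomial `∑_j (α_j cos(2 π (j+1) x) + β_j sin(2 π (j+1) x))`. -/
noncomputable def harmonicPoly {n : ℕ} (α β : Fin n → ℂ) (x : ℝ) : ℂ :=
  ∑ j : Fin n, (α j * (Real.cos (2 * Real.pi * ((j : ℝ) + 1) * x) : ℂ)
    + β j * (Real.sin (2 * Real.pi * ((j : ℝ) + 1) * x) : ℂ))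

/-- The frequency `±(j + 1)`. -/
def signedFreq {n : ℕ} (p : Fin n × Bool) : ℤ :=
  if p.2 then (p.1 : ℤ) + 1 else -((p.1 : ℤ) + 1)

/-- The Fourier coefficients of `harmonicPoly`. -/
noncomputable def fourierCoef {n : ℕ} (α β : Fin n → ℂ) (p : Fin n × Bool) : ℂ :=
  if p.2 then (α p.1 - Complex.I * β p.1) / 2 else (α p.1 + Complex.I * β p.1) / 2

lemma harmonicPoly_eq_sum_expi {n : ℕ} (α β : Fin n → ℂ) (x : ℝ) :
    harmonicPoly α β x = ∑ p, fourierCoef α β p * expi (signedFreq p) x := by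
  rw [Fintype.sum_prod_type, harmonicPoly]
  refine Finset.sum_congr rfl fun j _ => ?_
  simp only [Fintype.sum_bool, fourierCoef, signedFreq, if_true, Bool.false_eq_true, if_false,
    expi, Complex.ofReal_cos, Complex.ofReal_sin, Complex.cos, Complex.sin]
  push_cast
  have e1 : 2 * (Real.pi : ℂ) * ((j : ℂ) + 1) * x * Complex.I
      = 2 * Real.pi * Complex.I * ((j : ℂ) + 1) * x := by ring
  have e2 : -(2 * (Real.pi : ℂ) * ((j : ℂ) + 1) * x) * Complex.I
      = 2 * Real.pi * Complex.I * (-1 + -(j : ℂ)) * x := by ring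
  have e3 : 2 * (Real.pi : ℂ) * Complex.I * -((j : ℂ) + 1) * x
      = 2 * Real.pi * Complex.I * (-1 + -(j : ℂ)) * x := by ring
  rw [e1, e2, e3]
  ring

lemma abs_signedFreq {n : ℕ} (p : Fin n × Bool) :
    0 < |signedFreq p| ∧ |signedFreq p| ≤ n := by
  have h1 := p.1.isLt
  have : |signedFreq p| = (p.1 : ℤ) + 1 := by
    unfold signedFreq
    split_ifs
    · exact abs_of_pos (by omega)
    · rw [abs_neg]; exact abs_of_pos (by omega)
  omega

lemma signedFreq_add_eq_zero_iff {n : ℕ} (p q : Fin n × Bool) :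
    signedFreq p + signedFreq q = 0 ↔ q = (p.1, !p.2) := by
  obtain ⟨j, s⟩ := p
  obtain ⟨k, r⟩ := q
  cases s <;> cases r <;> simp [signedFreq, Fin.ext_iff] <;> omega

lemma continuous_harmonicPoly {n : ℕ} (α β : Fin n → ℂ) : Continuous (harmonicPoly α β) := by
  unfold harmonicPoly
  fun_prop

lemma periodic_harmonicPoly {n : ℕ} (α β : Fin n → ℂ) :
    Function.Periodic (harmonicPoly α β) 1 := by
  intro x
  simp only [harmonicPoly_eq_sum_expi, periodic_expi _ x]

lemma norm_harmonicPoly_le {n : ℕ} {α β : Fin n → ℂ} {M : ℝ} (hα : ∀ j, ‖α j‖ ≤ M)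
    (hβ : ∀ j, ‖β j‖ ≤ M) (x : ℝ) : ‖harmonicPoly α β x‖ ≤ n * (2 * M) := by
  refine (norm_sum_le_of_le (f := fun j : Fin n => _) (n := fun _ => 2 * M) _
    fun j _ => ?_).trans (by simp)
  have hM : 0 ≤ M := (norm_nonneg _).trans (hα j)
  refine (norm_add_le _ _).trans ?_
  rw [norm_mul, norm_mul, Complex.norm_real, Complex.norm_real, Real.norm_eq_abs,
    Real.norm_eq_abs]
  have h1 := mul_le_mul (hα j) (Real.abs_cos_le_one (2 * Real.pi * ((j : ℝ) + 1) * x))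
    (abs_nonneg _) hM
  have h2 := mul_le_mul (hβ j) (Real.abs_sin_le_one (2 * Real.pi * ((j : ℝ) + 1) * x))
    (abs_nonneg _) hM
  linarith

lemma branchAvg_harmonicPoly {b : ℕ} (hb : b ≠ 0) (α β : Fin (b - 1) → ℂ) (y : ℝ) :
    branchAvg b (harmonicPoly α β) y = 0 := by
  rw [show harmonicPoly α β = _ from funext (harmonicPoly_eq_sum_expi α β), branchAvg_sum]
  refine Finset.sum_eq_zero fun p _ => ?_
  have h := abs_signedFreq p
  rw [branchAvg_const_mul, branchAvg_expi_of_not_dvd hb, mul_zero]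
  intro hd
  have := Int.eq_zero_of_abs_lt_dvd hd (by omega)
  simp [this] at h

/-- One average does not suffice: the sums ±b of two frequencies become ±1. After the second, only
pairs of opposite frequencies contribute. Squares, not squared moduli, appear, so the identity holds
for complex coefficients. -/
lemma branchAvg_branchAvg_harmonicPoly_sq {b : ℕ} (hb : b ≠ 0) (α β : Fin (b - 1) → ℂ) (y : ℝ) :
    branchAvg b (branchAvg b fun x => harmonicPoly α β x ^ 2) y
      = ∑ j, (α j ^ 2 + β j ^ 2) / 2 := by
  have hsq : (fun x => harmonicPoly α β x ^ 2) = fun x => ∑ p, ∑ q,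
      (fourierCoef α β p * fourierCoef α β q) * expi (signedFreq p + signedFreq q) x := by
    ext x
    rw [harmonicPoly_eq_sum_expi, sq, Finset.sum_mul_sum]
    refine Finset.sum_congr rfl fun p _ => Finset.sum_congr rfl fun q _ => ?_
    rw [expi_add]
    ring
  have h1 : branchAvg b (fun x => harmonicPoly α β x ^ 2) = fun y => ∑ p, ∑ q,
      (fourierCoef α β p * fourierCoef α β q)
        * branchAvg b (expi (signedFreq p + signedFreq q)) y := by
    ext y
    rw [hsq]
    simp only [branchAvg_sum, branchAvg_const_mul]
  have h2 (p q : Fin (b - 1) × Bool) : |signedFreq p + signedFreq q| < b * b := by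
    have hp := abs_signedFreq p
    have hq := abs_signedFreq q
    have := abs_add_le (signedFreq p) (signedFreq q)
    -- The nonzero frequency of p, at most b - 1 in absolute value, rules out b = 1.
    have hb2 : 2 ≤ b := by omega
    have : (2 : ℤ) * b ≤ b * b := by exact_mod_cast Nat.mul_le_mul_right b hb2
    omega
  rw [h1]
  simp only [branchAvg_sum, branchAvg_const_mul, branchAvg_branchAvg_expi hb (h2 _ _),
    signedFreq_add_eq_zero_iff, mul_ite, mul_one, mul_zero, Finset.sum_ite_eq', Finset.mem_univ,
    if_true]
  rw [Fintype.sum_prod_type_right, Fintype.sum_bool, ← Finset.sum_add_distrib]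
  refine Finset.sum_congr rfl fun j _ => ?_
  simp only [fourierCoef, Bool.not_true, Bool.not_false, if_true, Bool.false_eq_true, if_false]
  linear_combination (-(β j) ^ 2 / 2) * Complex.I_sq

/-! ### Laplace transforms of complex lacunary polynomials. -/

/-- The complex version of `lacunaryPoly`. -/
noncomputable def complexLacunaryPoly (b : ℕ) (α β : Fin (b - 1) → ℕ → ℂ) (m : ℕ) (u : ℝ) : ℂ :=
  ∑ t ∈ Finset.Icc 1 m, ∑ j,
    (α j t * (Real.cos (2 * Real.pi * (freq b j t : ℝ) * u) : ℂ)
      + β j t * (Real.sin (2 * Real.pi * (freq b j t : ℝ) * u) : ℂ))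

lemma sum_Icc_one_eq_sum_range {A : Type*} [AddCommMonoid A] (f : ℕ → A) (m : ℕ) :
    ∑ t ∈ Finset.Icc 1 m, f t = ∑ t ∈ Finset.range m, f (t + 1) := by
  rw [Finset.range_eq_Ico, Finset.sum_Ico_add' f 0 m 1]
  rfl

lemma complexLacunaryPoly_eq_sum_range (b : ℕ) (α β : Fin (b - 1) → ℕ → ℂ) (m : ℕ) (u : ℝ) :
    complexLacunaryPoly b α β m u = ∑ t ∈ Finset.range m,
      harmonicPoly (fun j => α j (t + 1)) (fun j => β j (t + 1)) ((b : ℝ) ^ t * u) := by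
  rw [complexLacunaryPoly, sum_Icc_one_eq_sum_range]
  refine Finset.sum_congr rfl fun t _ => Finset.sum_congr rfl fun j _ => ?_
  have : 2 * Real.pi * (freq b j (t + 1) : ℝ) * u
      = 2 * Real.pi * ((j : ℝ) + 1) * ((b : ℝ) ^ t * u) := by
    simp only [freq, Nat.add_sub_cancel]
    push_cast
    ring
  rw [this]

/-- Asymptotics of the Laplace transform of a normalized complex lacunary polynomial. -/
theorem tendsto_integral_exp_complexLacunaryPoly_sub {b : ℕ} (hb : b ≠ 0)
    {α β : Fin (b - 1) → ℕ → ℂ} {M : ℝ} (hα : ∀ j t, 1 ≤ t → ‖α j t‖ ≤ M)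
    (hβ : ∀ j t, 1 ≤ t → ‖β j t‖ ≤ M) :
    Tendsto (fun m : ℕ => (∫ u in (0 : ℝ)..1,
        Complex.exp (((√(m : ℝ))⁻¹ : ℝ) * complexLacunaryPoly b α β m u))
      - Complex.exp ((4 : ℂ)⁻¹ * ((m : ℂ)⁻¹ *
        ∑ t ∈ Finset.Icc 1 m, ∑ j, (α j t ^ 2 + β j t ^ 2)))) atTop (𝓝 0) := by
  -- K is the sup bound of each harmonic block. The estimate is applied with κ = K/√m, so that mκ² =
  -- K² stays fixed while mκ³ tends to 0.
  set K : ℝ := (b - 1 : ℕ) * (2 * M) with hK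
  have hsqrt : Tendsto (fun m : ℕ => (√(m : ℝ))⁻¹) atTop (𝓝 0) :=
    tendsto_inv_atTop_zero.comp (Real.tendsto_sqrt_atTop.comp tendsto_natCast_atTop_atTop)
  have hlim : Tendsto (fun m : ℕ => (6 * K ^ 3 * (√(m : ℝ))⁻¹ + K ^ 2 * ((√(m : ℝ))⁻¹) ^ 2)
      * Real.exp (K ^ 2)) atTop (𝓝 0) := by
    have := ((hsqrt.const_mul (6 * K ^ 3)).add ((hsqrt.pow 2).const_mul (K ^ 2))).mul_const
      (Real.exp (K ^ 2))
    simpa using this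
  refine squeeze_zero_norm' ?_ hlim
  have hsmall : ∀ᶠ m : ℕ in atTop, K * (√(m : ℝ))⁻¹ ≤ 1 := by
    have := hsqrt.const_mul K
    rw [mul_zero] at this
    exact this.eventually_le_const one_pos
  filter_upwards [hsmall, eventually_gt_atTop 0] with m hm hm0
  have hmR : (0 : ℝ) < m := by exact_mod_cast hm0
  set ε : ℝ := (√(m : ℝ))⁻¹ with hε
  have hε0 : 0 ≤ ε := by positivity
  have hε2 : ε ^ 2 = (m : ℝ)⁻¹ := by rw [hε, inv_pow, Real.sq_sqrt hmR.le]
  have hε2c : (ε : ℂ) ^ 2 = (m : ℂ)⁻¹ := by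
    rw [← Complex.ofReal_pow, hε2]
    push_cast
    rfl
  have hmε : (m : ℝ) * ε ^ 2 = 1 := by rw [hε2]; field_simp
  have h := norm_integral_exp_sum_sub_exp_le hb
    (g := fun t x => (ε : ℂ) * harmonicPoly (fun j => α j (t + 1)) (fun j => β j (t + 1)) x)
    -- The double average of the squared block is m⁻¹ Σ_j (α² + β²)/2 = 2V, whence the factor 1/4.
    (V := fun t => (4 : ℂ)⁻¹ * ((m : ℂ)⁻¹ * ∑ j, (α j (t + 1) ^ 2 + β j (t + 1) ^ 2)))
    (κ := K * ε) hm (fun t => continuous_const.mul (continuous_harmonicPoly _ _))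
    (fun t x => by simp only [periodic_harmonicPoly _ _ x])
    (fun t x => by
      rw [norm_mul, Complex.norm_real, Real.norm_of_nonneg hε0, mul_comm]
      gcongr
      exact norm_harmonicPoly_le (fun j => hα j _ (by omega)) (fun j => hβ j _ (by omega)) x)
    (fun t y => by rw [branchAvg_const_mul, branchAvg_harmonicPoly hb, mul_zero])
    (fun t y => by
      have : branchAvg b (fun x => ((ε : ℂ) * harmonicPoly (fun j => α j (t + 1))
          (fun j => β j (t + 1)) x) ^ 2) = fun y => (ε : ℂ) ^ 2 * branchAvg b
            (fun x => harmonicPoly (fun j => α j (t + 1)) (fun j => β j (t + 1)) x ^ 2) y := by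
        ext y
        rw [← branchAvg_const_mul]
        simp only [mul_pow]
      rw [this, branchAvg_const_mul, branchAvg_branchAvg_harmonicPoly_sq hb, hε2c,
        ← Finset.sum_div]
      ring) m
  simp only [← Finset.mul_sum, ← complexLacunaryPoly_eq_sum_range] at h
  rw [sum_Icc_one_eq_sum_range]
  refine h.trans (le_of_eq ?_)
  have e1 : (m : ℝ) * (K * ε) ^ 2 = K ^ 2 := by linear_combination K ^ 2 * hmε
  rw [e1]
  linear_combination 6 * K ^ 3 * ε * Real.exp (K ^ 2) * hmε

/-! ### Gaussian laws and the noncentral chi-square law. -/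

lemma charFun_complexGaussian (a c : ℝ) (z : ℂ) :
    charFun (((gaussianReal a (1 / 2)).prod (gaussianReal c (1 / 2))).map
      Complex.measurableEquivRealProd.symm) z
      = Complex.exp ((a * z.re + c * z.im : ℝ) * Complex.I - (‖z‖ ^ 2 / 4 : ℝ)) := by
  have h1 (p : ℝ × ℝ) : Complex.exp ((inner ℝ (Complex.measurableEquivRealProd.symm p) z : ℝ)
      * Complex.I) = Complex.exp ((inner ℝ p.1 z.re : ℝ) * Complex.I)
        * Complex.exp ((inner ℝ p.2 z.im : ℝ) * Complex.I) := by
    rw [← Complex.exp_add]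
    congr 1
    simp [Complex.inner, Complex.measurableEquivRealProd]
    ring
  rw [charFun_apply, integral_map_equiv]
  simp_rw [h1]
  rw [integral_prod_mul (fun x : ℝ => Complex.exp ((inner ℝ x z.re : ℝ) * Complex.I))
    (fun x : ℝ => Complex.exp ((inner ℝ x z.im : ℝ) * Complex.I)), ← charFun_apply,
    ← charFun_apply, charFun_gaussianReal, charFun_gaussianReal, ← Complex.exp_add]
  congr 1
  rw [← Complex.normSq_eq_norm_sq, Complex.normSq_apply]
  push_cast
  ring

lemma charFun_complexNormal {n : ℕ} (δ : Fin n → ℂ) (t : PiLp 2 fun _ : Fin n => ℂ) :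
    charFun ((complexNormal δ).map (WithLp.toLp 2)) t
      = Complex.exp ((inner ℝ (WithLp.toLp 2 δ) t : ℝ) * Complex.I - (‖t‖ ^ 2 / 4 : ℝ)) := by
  have (j : Fin n) : IsProbabilityMeasure
      (((gaussianReal (δ j).re (1 / 2)).prod (gaussianReal (δ j).im (1 / 2))).map
        Complex.measurableEquivRealProd.symm) :=
    Measure.isProbabilityMeasure_map Complex.measurableEquivRealProd.symm.measurable.aemeasurable
  rw [complexNormal, charFun_pi]
  simp_rw [charFun_complexGaussian]
  rw [← Complex.exp_sum]
  congr 1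
  rw [Finset.sum_sub_distrib, ← Finset.sum_mul, ← Complex.ofReal_sum, ← Complex.ofReal_sum,
    ← Finset.sum_div, PiLp.norm_sq_eq_of_L2, PiLp.inner_apply]
  congr 4
  ext j
  simp [Complex.inner]
  ring

/-- The factor √2 turns the variances 1/2 into 1, giving a translate of the standard Gaussian of a
real 2n-dimensional inner product space. -/
lemma complexNormal_map_sqrt_two_smul {n : ℕ} (δ : Fin n → ℂ) :
    ((complexNormal δ).map (WithLp.toLp 2)).map (fun x => √2 • x)
      = (stdGaussian (PiLp 2 fun _ : Fin n => ℂ)).map (fun x => x + √2 • WithLp.toLp 2 δ) := by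
  have := Measure.isProbabilityMeasure_map (μ := complexNormal δ) (f := WithLp.toLp 2)
    (by fun_prop)
  have h1 : IsProbabilityMeasure (((complexNormal δ).map (WithLp.toLp 2)).map fun x => √2 • x) :=
    Measure.isProbabilityMeasure_map (by fun_prop)
  have h2 : IsProbabilityMeasure ((stdGaussian (PiLp 2 fun _ : Fin n => ℂ)).map
      (fun x => x + √2 • WithLp.toLp 2 δ)) := Measure.isProbabilityMeasure_map (by fun_prop)
  refine Measure.ext_of_charFun (funext fun t => ?_)
  rw [charFun_map_smul, charFun_complexNormal, charFun_map_add_const, charFun_stdGaussian,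
    ← Complex.exp_add, norm_smul, mul_pow, inner_smul_left, inner_smul_right]
  congr 1
  rw [Real.norm_of_nonneg (Real.sqrt_nonneg 2), Real.sq_sqrt zero_le_two]
  simp
  ring

lemma map_pi_gaussianReal_eq_stdGaussian_map_add {ι : Type*} [Fintype ι] (μ : ι → ℝ) :
    (Measure.pi fun i => gaussianReal (μ i) 1).map (WithLp.toLp 2)
      = (stdGaussian (EuclideanSpace ℝ ι)).map (fun x => x + WithLp.toLp 2 μ) := by
  have h1 : IsProbabilityMeasure ((Measure.pi fun i => gaussianReal (μ i) 1).map
      (WithLp.toLp 2)) := Measure.isProbabilityMeasure_map (by fun_prop)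
  have h2 : IsProbabilityMeasure ((stdGaussian (EuclideanSpace ℝ ι)).map
      (fun x => x + WithLp.toLp 2 μ)) := Measure.isProbabilityMeasure_map (by fun_prop)
  refine Measure.ext_of_charFun (E := EuclideanSpace ℝ ι) (funext fun t => ?_)
  rw [charFun_pi, charFun_map_add_const, charFun_stdGaussian, ← Complex.exp_add]
  simp_rw [charFun_gaussianReal]
  rw [← Complex.exp_sum]
  congr 1
  rw [Finset.sum_sub_distrib, ← Finset.sum_mul, ← Complex.ofReal_pow,
    EuclideanSpace.norm_sq_eq, PiLp.inner_apply, sub_eq_neg_add]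
  congr 1
  · rw [← Finset.sum_div, ← neg_div, Complex.ofReal_sum]
    simp
  · simp

/-- Rotation invariance: the law of `‖x + v‖ ^ 2`, `x` standard Gaussian, depends on the dimension
and on `‖v‖` only. -/
lemma stdGaussian_map_norm_add_sq_eq {E F : Type*} [NormedAddCommGroup E] [InnerProductSpace ℝ E]
    [FiniteDimensional ℝ E] [MeasurableSpace E] [BorelSpace E] [NormedAddCommGroup F]
    [InnerProductSpace ℝ F] [FiniteDimensional ℝ F] [MeasurableSpace F] [BorelSpace F]
    (h : Module.finrank ℝ E = Module.finrank ℝ F) {v : E} {w : F} (hvw : ‖v‖ = ‖w‖) :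
    (stdGaussian E).map (fun x => ‖x + v‖ ^ 2) = (stdGaussian F).map (fun x => ‖x + w‖ ^ 2) := by
  let e : E ≃ₗᵢ[ℝ] F := ((stdOrthonormalBasis ℝ E).reindex (finCongr h)).repr.trans
    (stdOrthonormalBasis ℝ F).repr.symm
  -- The reflection in the hyperplane orthogonal to the difference of two vectors of equal norm
  -- exchanges them.
  let r : F ≃ₗᵢ[ℝ] F := (Submodule.span ℝ {e v - w})ᗮ.reflection
  have hr : r (e v) = w := Submodule.reflection_sub (by rw [e.norm_map, hvw])
  let f : E ≃ₗᵢ[ℝ] F := e.trans r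
  rw [← stdGaussian_map f, Measure.map_map (by fun_prop) (by fun_prop)]
  congr 1
  ext x
  simp only [Function.comp]
  rw [show w = f v from hr.symm, ← map_add, LinearIsometryEquiv.norm_map]

/-- The squared norm of a complex normal vector is a noncentral chi-square variable. -/
lemma complexNormal_map_norm_sq {n : ℕ} (hn : 0 < n) (δ : Fin n → ℂ) :
    (complexNormal δ).map (fun z => 2 * ∑ j, ‖z j‖ ^ 2)
      = noncentralChiSq (2 * n) (2 * ∑ j, ‖δ j‖ ^ 2) := by
  set l : ℝ := 2 * ∑ j, ‖δ j‖ ^ 2 with hl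
  have hl0 : 0 ≤ l := by positivity
  set μ : Fin (2 * n) → ℝ := fun i => if (i : ℕ) = 0 then √l else 0 with hμ
  have hnorm (z : Fin n → ℂ) :
      2 * ∑ j, ‖z j‖ ^ 2 = ‖√2 • (WithLp.toLp 2 z : PiLp 2 fun _ : Fin n => ℂ)‖ ^ 2 := by
    rw [norm_smul, mul_pow, Real.norm_of_nonneg (Real.sqrt_nonneg 2), Real.sq_sqrt zero_le_two,
      PiLp.norm_sq_eq_of_L2]
  have h1 : (complexNormal δ).map (fun z => 2 * ∑ j, ‖z j‖ ^ 2)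
      = (((complexNormal δ).map (WithLp.toLp 2)).map (fun x => √2 • x)).map
        (fun x : PiLp 2 fun _ : Fin n => ℂ => ‖x‖ ^ 2) := by
    rw [Measure.map_map (by fun_prop) (by fun_prop), Measure.map_map (by fun_prop) (by fun_prop)]
    congr 1
    ext z
    exact hnorm z
  have h2 : noncentralChiSq (2 * n) l = ((Measure.pi fun i => gaussianReal (μ i) 1).map
      (WithLp.toLp 2)).map (fun x : EuclideanSpace ℝ (Fin (2 * n)) => ‖x‖ ^ 2) := by
    rw [Measure.map_map (by fun_prop) (by fun_prop), noncentralChiSq]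
    congr 1
    ext x
    simp [EuclideanSpace.norm_sq_eq]
  have hμn : ‖(WithLp.toLp 2 μ : EuclideanSpace ℝ (Fin (2 * n)))‖ ^ 2 = l := by
    -- Coordinate 0, which carries the whole mean, exists because n > 0.
    rw [EuclideanSpace.norm_sq_eq, Finset.sum_eq_single (⟨0, by omega⟩ : Fin (2 * n))]
    · simp [hμ, Real.sq_sqrt hl0]
    · intro i _ hi
      have : (i : ℕ) ≠ 0 := fun h => hi (Fin.ext h)
      simp [hμ, this]
    · simp
  have hfin : Module.finrank ℝ (PiLp 2 fun _ : Fin n => ℂ)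
      = Module.finrank ℝ (EuclideanSpace ℝ (Fin (2 * n))) := by
    rw [LinearEquiv.finrank_eq (WithLp.linearEquiv 2 ℝ (Fin n → ℂ)), finrank_euclideanSpace,
      Module.finrank_pi_fintype]
    simp [mul_comm]
  rw [h1, h2, complexNormal_map_sqrt_two_smul, map_pi_gaussianReal_eq_stdGaussian_map_add,
    Measure.map_map (by fun_prop) (by fun_prop), Measure.map_map (by fun_prop) (by fun_prop)]
  refine stdGaussian_map_norm_add_sq_eq hfin ?_
  rw [← sq_eq_sq₀ (norm_nonneg _) (norm_nonneg _), hμn, ← hnorm]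

/-! ### Truncation of digits. -/

lemma abs_trunc_sub_le {b : ℕ} [NeZero b] {u : ℝ} (hu : u ∈ Set.Ico (0 : ℝ) 1) (m : ℕ) :
    |trunc b m u - u| ≤ ((b : ℝ) ^ m)⁻¹ := by
  have heq : trunc b m u = ∑ i ∈ Finset.range m, Real.ofDigitsTerm (u.digits b) i := rfl
  have h1 := Real.sum_ofDigitsTerm_digits_le (b := b) hu m
  have h2 := Real.le_sum_ofDigitsTerm_digits (b := b) hu m
  rw [inv_pow] at h2
  rw [heq, abs_le]
  constructor
  · linarith
  · have : 0 ≤ ((b : ℝ) ^ m)⁻¹ := by positivity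
    linarith

lemma measurable_trunc (b : ℕ) [NeZero b] (m : ℕ) : Measurable (trunc b m) := by
  unfold trunc
  refine Finset.measurable_sum _ fun t _ => Measurable.div_const ?_ _
  have h : Measurable fun n : ℕ => ((Fin.ofNat b n : ℕ) : ℝ) := measurable_of_countable _
  exact h.comp (Nat.measurable_floor.comp (measurable_id.mul_const _))

lemma measurable_harmonicVector (b : ℕ) [NeZero b] (m : ℕ) : Measurable (harmonicVector b m) := by
  have := measurable_trunc b m
  unfold harmonicVector harmonicMean harmonic
  fun_prop

lemma continuous_lacunaryPoly (b : ℕ) (θc θs : Fin (b - 1) → ℕ → ℝ) (m : ℕ) :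
    Continuous (lacunaryPoly b θc θs m) := by
  unfold lacunaryPoly
  fun_prop

lemma sum_Icc_pow_le {b : ℕ} (hb : 2 ≤ b) (m : ℕ) :
    ∑ t ∈ Finset.Icc 1 m, (b : ℝ) ^ t ≤ 2 * (b : ℝ) ^ m := by
  have hb' : (2 : ℝ) ≤ b := by exact_mod_cast hb
  induction m with
  | zero => simp
  | succ m ih =>
    rw [Finset.sum_Icc_succ_top (by omega), pow_succ]
    have : 0 < (b : ℝ) ^ m := by positivity
    nlinarith

lemma freq_le {b : ℕ} (j : Fin (b - 1)) {t : ℕ} (ht : 1 ≤ t) : (freq b j t : ℝ) ≤ (b : ℝ) ^ t := by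
  have h : freq b j t ≤ b ^ t := by
    obtain ⟨s, rfl⟩ := Nat.exists_eq_add_of_le' ht
    rw [freq, Nat.add_sub_cancel, pow_succ']
    exact Nat.mul_le_mul_right _ (by omega)
  exact_mod_cast h

/-- A lacunary polynomial with constant coefficients changes by a bounded amount when its argument
is truncated. -/
lemma abs_lacunaryPoly_trunc_sub_le {b : ℕ} [NeZero b] (hb : 2 ≤ b) (a c : Fin (b - 1) → ℝ)
    (m : ℕ) {u : ℝ} (hu : u ∈ Set.Ico (0 : ℝ) 1) :
    |lacunaryPoly b (fun j _ => a j) (fun j _ => c j) m (trunc b m u)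
        - lacunaryPoly b (fun j _ => a j) (fun j _ => c j) m u|
      ≤ 4 * Real.pi * ∑ j, (|a j| + |c j|) := by
  have hbm : (0 : ℝ) < (b : ℝ) ^ m := by
    have : 0 < b := by omega
    positivity
  set S := ∑ j, (|a j| + |c j|) with hS
  have hS0 : 0 ≤ S := by positivity
  have hterm (t : ℕ) (ht : t ∈ Finset.Icc 1 m) (j : Fin (b - 1)) :
      |(a j * Real.cos (2 * Real.pi * (freq b j t : ℝ) * trunc b m u)
          + c j * Real.sin (2 * Real.pi * (freq b j t : ℝ) * trunc b m u))
        - (a j * Real.cos (2 * Real.pi * (freq b j t : ℝ) * u)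
          + c j * Real.sin (2 * Real.pi * (freq b j t : ℝ) * u))|
        ≤ (|a j| + |c j|) * (2 * Real.pi * (b : ℝ) ^ t * ((b : ℝ) ^ m)⁻¹) := by
    set x := 2 * Real.pi * (freq b j t : ℝ) * trunc b m u with hx
    set y := 2 * Real.pi * (freq b j t : ℝ) * u with hy
    have hxy : |x - y| ≤ 2 * Real.pi * (b : ℝ) ^ t * ((b : ℝ) ^ m)⁻¹ := by
      rw [hx, hy, ← mul_sub, abs_mul, abs_of_nonneg (by positivity)]
      gcongr
      · exact freq_le j (Finset.mem_Icc.mp ht).1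
      · exact abs_trunc_sub_le hu m
    have hcos : |Real.cos x - Real.cos y| ≤ |x - y| := by
      simpa [Real.dist_eq] using Real.lipschitzWith_cos.dist_le_mul x y
    have hsin : |Real.sin x - Real.sin y| ≤ |x - y| := by
      simpa [Real.dist_eq] using Real.lipschitzWith_sin.dist_le_mul x y
    calc _ = |a j * (Real.cos x - Real.cos y) + c j * (Real.sin x - Real.sin y)| := by
          congr 1; ring
      _ ≤ |a j| * |x - y| + |c j| * |x - y| := by
          refine (abs_add_le _ _).trans ?_
          rw [abs_mul, abs_mul]
          gcongr
      _ ≤ _ := by rw [← add_mul]; gcongr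
  rw [lacunaryPoly, lacunaryPoly, ← Finset.sum_sub_distrib]
  simp_rw [← Finset.sum_sub_distrib]
  calc _ ≤ ∑ t ∈ Finset.Icc 1 m, ∑ j,
        (|a j| + |c j|) * (2 * Real.pi * (b : ℝ) ^ t * ((b : ℝ) ^ m)⁻¹) :=
        (Finset.abs_sum_le_sum_abs _ _).trans (Finset.sum_le_sum fun t ht =>
          (Finset.abs_sum_le_sum_abs _ _).trans (Finset.sum_le_sum fun j _ => hterm t ht j))
    _ = 2 * Real.pi * S * ((b : ℝ) ^ m)⁻¹ * ∑ t ∈ Finset.Icc 1 m, (b : ℝ) ^ t := by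
        rw [Finset.mul_sum]
        refine Finset.sum_congr rfl fun t _ => ?_
        rw [← Finset.sum_mul]
        ring
    _ ≤ 2 * Real.pi * S * ((b : ℝ) ^ m)⁻¹ * (2 * (b : ℝ) ^ m) := by
        gcongr
        exact sum_Icc_pow_le hb m
    _ = _ := by field_simp; ring

/-- Real-linear functionals of e^{ix} are combinations of cos x and sin x. This reduces
characteristic functions of the harmonic vector to lacunary polynomials with coefficients constant
in time. -/
lemma inner_harmonicVector (b : ℕ) [NeZero b] (m : ℕ) (u : ℝ)
    (t : PiLp 2 fun _ : Fin (b - 1) => ℂ) :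
    inner ℝ (WithLp.toLp 2 (harmonicVector b m u)) t
      = (√(m : ℝ))⁻¹ * lacunaryPoly b (fun j _ => (t j).re) (fun j _ => (t j).im) m
        (trunc b m u) := by
  have hsq : √(m : ℝ) * (m : ℝ)⁻¹ = (√(m : ℝ))⁻¹ := by
    rcases Nat.eq_zero_or_pos m with rfl | hm
    · simp
    · have : (0 : ℝ) < m := by exact_mod_cast hm
      rw [← Real.sqrt_div_self, div_eq_mul_inv]
  have hz (j : Fin (b - 1)) (s : ℕ) : inner ℝ (harmonic b m j s u) (t j)
      = (t j).re * Real.cos (2 * Real.pi * (freq b j s : ℝ) * trunc b m u)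
        + (t j).im * Real.sin (2 * Real.pi * (freq b j s : ℝ) * trunc b m u) := by
    have : harmonic b m j s u
        = Complex.exp ((2 * Real.pi * (freq b j s : ℝ) * trunc b m u : ℝ) * Complex.I) := by
      rw [harmonic]
      congr 1
      push_cast
      ring
    rw [this, Complex.inner, Complex.mul_re, Complex.conj_re, Complex.conj_im,
      Complex.exp_ofReal_mul_I_re, Complex.exp_ofReal_mul_I_im]
    ring
  rw [PiLp.inner_apply, lacunaryPoly, Finset.sum_comm, Finset.mul_sum]
  refine Finset.sum_congr rfl fun j _ => ?_
  have h2 : harmonicVector b m u j = (√(m : ℝ))⁻¹ • ∑ s ∈ Finset.Icc 1 m, harmonic b m j s u := by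
    rw [harmonicVector, harmonicMean, ← hsq, Complex.real_smul]
    push_cast
    ring
  change inner ℝ (harmonicVector b m u j) (t j) = _
  rw [h2, real_inner_smul_left, sum_inner]
  simp_rw [hz]

/-! ### Characteristic functions under the local alternatives. -/

lemma integral_unifLaw {E : Type*} [NormedAddCommGroup E] [NormedSpace ℝ E] (f : ℝ → E) :
    ∫ u, f u ∂unifLaw = ∫ u in (0 : ℝ)..1, f u := by
  rw [unifLaw, integral_Icc_eq_integral_Ioc, intervalIntegral.integral_of_le zero_le_one]

lemma ae_unifLaw_mem_Ico : ∀ᵐ u ∂unifLaw, u ∈ Set.Ico (0 : ℝ) 1 := by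
  rw [unifLaw, restrict_Ico_eq_restrict_Icc.symm]
  exact ae_restrict_mem measurableSet_Ico

/-- The characteristic function of the harmonic vector under the local alternative is
asymptotic to the integral computed without truncation. -/
lemma tendsto_charFun_sub_integral {b : ℕ} [NeZero b] (hb : 2 ≤ b)
    (θc θs : Fin (b - 1) → ℕ → ℝ) (t : PiLp 2 fun _ : Fin (b - 1) => ℂ) :
    Tendsto (fun m : ℕ =>
      charFun ((altLaw b θc θs m).map fun u => WithLp.toLp 2 (harmonicVector b m u)) t
        - ∫ u, Complex.exp (((√(m : ℝ))⁻¹ * lacunaryPoly b (fun j _ => (t j).re)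
          (fun j _ => (t j).im) m u : ℝ) * Complex.I) ∂(altLaw b θc θs m)) atTop (𝓝 0) := by
  set A : ℕ → ℝ → ℝ := lacunaryPoly b (fun j _ => (t j).re) (fun j _ => (t j).im) with hA
  set S := 4 * Real.pi * ∑ j, (|(t j).re| + |(t j).im|) with hS
  have hsqrt : Tendsto (fun m : ℕ => (√(m : ℝ))⁻¹ * S) atTop (𝓝 0) := by
    have : Tendsto (fun m : ℕ => (√(m : ℝ))⁻¹) atTop (𝓝 0) :=
      tendsto_inv_atTop_zero.comp (Real.tendsto_sqrt_atTop.comp tendsto_natCast_atTop_atTop)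
    simpa using this.mul_const S
  refine squeeze_zero_norm (fun m => ?_) hsqrt
  have hmeas : Measurable fun u => (WithLp.toLp 2 (harmonicVector b m u) :
      PiLp 2 fun _ : Fin (b - 1) => ℂ) := by
    have := measurable_harmonicVector b m
    fun_prop
  rw [charFun_apply, integral_map hmeas.aemeasurable (by fun_prop)]
  simp_rw [inner_harmonicVector]
  have hcA : Continuous (A m) := continuous_lacunaryPoly b _ _ m
  have hmT : Measurable fun u => A m (trunc b m u) := hcA.measurable.comp (measurable_trunc b m)
  have hi1 : Integrable (fun u => Complex.exp (((√(m : ℝ))⁻¹ * A m (trunc b m u) : ℝ)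
      * Complex.I)) (altLaw b θc θs m) :=
    Integrable.of_bound (by
      refine Measurable.aestronglyMeasurable ?_
      exact Complex.measurable_exp.comp
        ((Complex.measurable_ofReal.comp (hmT.const_mul _)).mul_const _)) 1
      (ae_of_all _ fun u => by rw [Complex.norm_exp_ofReal_mul_I])
  have hi2 : Integrable (fun u => Complex.exp (((√(m : ℝ))⁻¹ * A m u : ℝ)
      * Complex.I)) (altLaw b θc θs m) :=
    Integrable.of_bound (by fun_prop) 1 (ae_of_all _ fun u => by rw [Complex.norm_exp_ofReal_mul_I])
  rw [← integral_sub hi1 hi2]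
  -- The digit estimate is available only for u < 1; the endpoint is a null set.
  have hae : ∀ᵐ u ∂(altLaw b θc θs m), u ∈ Set.Ico (0 : ℝ) 1 :=
    (tilted_absolutelyContinuous _ _).ae_le ae_unifLaw_mem_Ico
  refine (norm_integral_le_of_norm_le_const (C := (√(m : ℝ))⁻¹ * S) ?_).trans (by simp)
  filter_upwards [hae] with u hu
  have h1 : Complex.exp (((√(m : ℝ))⁻¹ * A m (trunc b m u) : ℝ) * Complex.I)
      - Complex.exp (((√(m : ℝ))⁻¹ * A m u : ℝ) * Complex.I)
      = Complex.exp (((√(m : ℝ))⁻¹ * A m u : ℝ) * Complex.I)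
        * (Complex.exp (Complex.I * ((√(m : ℝ))⁻¹ * (A m (trunc b m u) - A m u) : ℝ)) - 1) := by
    rw [mul_sub, ← Complex.exp_add, mul_one]
    congr 2
    push_cast
    ring
  rw [h1, norm_mul, Complex.norm_exp_ofReal_mul_I, one_mul]
  refine (Real.norm_exp_I_mul_ofReal_sub_one_le).trans ?_
  rw [norm_mul, Real.norm_of_nonneg (by positivity), Real.norm_eq_abs]
  gcongr
  exact abs_lacunaryPoly_trunc_sub_le hb _ _ m hu

/-- Here N/D - c = ((N - Qc) - c(D - Q))/D, and D stays away from 0 because |Q| ≥ 1. Neither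
convergence nor boundedness of Q is required. -/
lemma tendsto_div_of_sub_mul_tendsto_zero {N D Q c : ℕ → ℂ} {ℓ : ℂ}
    (hN : Tendsto (fun m => N m - Q m * c m) atTop (𝓝 0))
    (hD : Tendsto (fun m => D m - Q m) atTop (𝓝 0)) (hc : Tendsto c atTop (𝓝 ℓ))
    (hQ : ∀ m, 1 ≤ ‖Q m‖) : Tendsto (fun m => N m / D m) atTop (𝓝 ℓ) := by
  have hDlow : ∀ᶠ m in atTop, 1 / 2 ≤ ‖D m‖ := by
    have := hD.norm
    rw [norm_zero] at this
    filter_upwards [this.eventually_le_const (show (0 : ℝ) < 1 / 2 by norm_num)] with m hm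
    have h1 := hQ m
    have h2 := norm_sub_norm_le (Q m) (D m)
    rw [norm_sub_rev] at h2
    linarith
  have hnum : Tendsto (fun m => (N m - Q m * c m) - c m * (D m - Q m)) atTop (𝓝 0) := by
    simpa using hN.sub (hc.mul hD)
  have hquot : Tendsto (fun m => ((N m - Q m * c m) - c m * (D m - Q m)) / D m) atTop (𝓝 0) := by
    have h2 : Tendsto (fun m => 2 * ‖(N m - Q m * c m) - c m * (D m - Q m)‖) atTop (𝓝 0) := by
      simpa using hnum.norm.const_mul 2
    refine squeeze_zero_norm' ?_ h2
    filter_upwards [hDlow] with m hm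
    rw [norm_div, div_le_iff₀ (by linarith)]
    nlinarith [norm_nonneg ((N m - Q m * c m) - c m * (D m - Q m))]
  have := hquot.add hc
  rw [zero_add] at this
  refine this.congr' ?_
  filter_upwards [hDlow] with m hm
  have hD0 : D m ≠ 0 := by
    intro h
    rw [h, norm_zero] at hm
    norm_num at hm
  field_simp
  ring

/-- The limit of the untruncated characteristic functions under the local alternatives. -/
lemma tendsto_integral_altLaw {b : ℕ} (hb : 2 ≤ b) {θc θs : Fin (b - 1) → ℕ → ℝ} {M : ℝ}
    (hθc : ∀ j t, 1 ≤ t → |θc j t| ≤ M) (hθs : ∀ j t, 1 ≤ t → |θs j t| ≤ M)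
    {θcLim θsLim : Fin (b - 1) → ℝ}
    (hc : ∀ j, Tendsto (fun m : ℕ => (m : ℝ)⁻¹ * ∑ t ∈ Finset.Icc 1 m, θc j t) atTop
      (𝓝 (θcLim j)))
    (hs : ∀ j, Tendsto (fun m : ℕ => (m : ℝ)⁻¹ * ∑ t ∈ Finset.Icc 1 m, θs j t) atTop
      (𝓝 (θsLim j))) (a c : Fin (b - 1) → ℝ) :
    Tendsto (fun m : ℕ => ∫ u, Complex.exp (((√(m : ℝ))⁻¹ *
        lacunaryPoly b (fun j _ => a j) (fun j _ => c j) m u : ℝ) * Complex.I)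
        ∂(altLaw b θc θs m)) atTop
      (𝓝 (Complex.exp ((∑ j, (θcLim j * a j + θsLim j * c j) / 2 : ℝ) * Complex.I
        - (∑ j, (a j ^ 2 + c j ^ 2) / 4 : ℝ)))) := by
  have hb0 : b ≠ 0 := by omega
  -- Q is the exponent of the normalizing constant. Averages of θ² are not assumed to converge, so
  -- it is kept apart from R, which does converge.
  set Q : ℕ → ℝ := fun m => 4⁻¹ * ((m : ℝ)⁻¹ *
    ∑ t ∈ Finset.Icc 1 m, ∑ j, (θc j t ^ 2 + θs j t ^ 2)) with hQ
  set R : ℕ → ℂ := fun m => (∑ j, (((m : ℝ)⁻¹ * ∑ t ∈ Finset.Icc 1 m, θc j t) * a j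
    + ((m : ℝ)⁻¹ * ∑ t ∈ Finset.Icc 1 m, θs j t) * c j) / 2 : ℝ) * Complex.I
    - (∑ j, (a j ^ 2 + c j ^ 2) / 4 : ℝ) with hR
  have hRlim : Tendsto (fun m => Complex.exp (R m)) atTop
      (𝓝 (Complex.exp ((∑ j, (θcLim j * a j + θsLim j * c j) / 2 : ℝ) * Complex.I
        - (∑ j, (a j ^ 2 + c j ^ 2) / 4 : ℝ)))) := by
    refine (Complex.continuous_exp.tendsto _).comp (Tendsto.sub_const (Tendsto.mul_const _
      ((Complex.continuous_ofReal.tendsto _).comp (tendsto_finsetSum _ fun j _ => ?_))) _)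
    exact (((hc j).mul_const _).add ((hs j).mul_const _)).div_const 2
  -- a common bound for the complex coefficients
  set B : ℝ := |M| + ∑ j, (|a j| + |c j|) with hB
  have hSa (j) : |a j| ≤ ∑ j, (|a j| + |c j|) :=
    (le_add_of_nonneg_right (abs_nonneg (c j))).trans
      (Finset.single_le_sum (f := fun j => |a j| + |c j|) (fun _ _ => by positivity)
        (Finset.mem_univ j))
  have hSc (j) : |c j| ≤ ∑ j, (|a j| + |c j|) :=
    (le_add_of_nonneg_left (abs_nonneg (a j))).trans
      (Finset.single_le_sum (f := fun j => |a j| + |c j|) (fun _ _ => by positivity)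
        (Finset.mem_univ j))
  have hbound {x y : ℝ} (hx : |x| ≤ M) (hy : |y| ≤ ∑ j, (|a j| + |c j|)) :
      ‖(x : ℂ) + y * Complex.I‖ ≤ B := by
    refine (norm_add_le _ _).trans ?_
    rw [norm_mul, Complex.norm_I, mul_one, Complex.norm_real, Complex.norm_real]
    exact add_le_add (hx.trans (le_abs_self M)) hy
  have hD := tendsto_integral_exp_complexLacunaryPoly_sub hb0
    (α := fun j t => (θc j t : ℂ)) (β := fun j t => (θs j t : ℂ)) (M := M)
    (fun j t ht => by simpa using hθc j t ht) (fun j t ht => by simpa using hθs j t ht)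
  have hN := tendsto_integral_exp_complexLacunaryPoly_sub hb0
    (α := fun j t => (θc j t : ℂ) + a j * Complex.I)
    (β := fun j t => (θs j t : ℂ) + c j * Complex.I) (M := B)
    (fun j t ht => hbound (hθc j t ht) (hSa j)) (fun j t ht => hbound (hθs j t ht) (hSc j))
  have hpolyD (m : ℕ) (u : ℝ) : complexLacunaryPoly b (fun j t => (θc j t : ℂ))
      (fun j t => (θs j t : ℂ)) m u = (lacunaryPoly b θc θs m u : ℝ) := by
    simp only [complexLacunaryPoly, lacunaryPoly]
    push_cast
    rfl
  have hpolyN (m : ℕ) (u : ℝ) : complexLacunaryPoly b (fun j t => (θc j t : ℂ) + a j * Complex.I)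
      (fun j t => (θs j t : ℂ) + c j * Complex.I) m u = (lacunaryPoly b θc θs m u : ℝ)
        + (lacunaryPoly b (fun j _ => a j) (fun j _ => c j) m u : ℝ) * Complex.I := by
    simp only [complexLacunaryPoly, lacunaryPoly]
    push_cast
    rw [Finset.sum_mul, ← Finset.sum_add_distrib]
    refine Finset.sum_congr rfl fun t _ => ?_
    rw [Finset.sum_mul, ← Finset.sum_add_distrib]
    refine Finset.sum_congr rfl fun j _ => ?_
    ring
  -- Expansion of (θ + ia)² = θ² + 2iaθ - a². The last term is constant in t, so its average equals
  -- a² only for m > 0.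
  have hexpN {m : ℕ} (hm : 0 < m) : (4 : ℂ)⁻¹ * ((m : ℂ)⁻¹ * ∑ t ∈ Finset.Icc 1 m, ∑ j,
      (((θc j t : ℂ) + a j * Complex.I) ^ 2 + ((θs j t : ℂ) + c j * Complex.I) ^ 2))
      = (Q m : ℝ) + R m := by
    have hmc : (m : ℂ) ≠ 0 := by exact_mod_cast hm.ne'
    have hsum : ∑ t ∈ Finset.Icc 1 m, ∑ j,
        (((θc j t : ℂ) + a j * Complex.I) ^ 2 + ((θs j t : ℂ) + c j * Complex.I) ^ 2)
        = ∑ t ∈ Finset.Icc 1 m, ∑ j, ((θc j t : ℂ) ^ 2 + (θs j t : ℂ) ^ 2)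
          + ∑ j, (2 * Complex.I * ((∑ t ∈ Finset.Icc 1 m, (θc j t : ℂ)) * a j
            + (∑ t ∈ Finset.Icc 1 m, (θs j t : ℂ)) * c j)
            - m * ((a j : ℂ) ^ 2 + (c j : ℂ) ^ 2)) := by
      have hconst (j : Fin (b - 1)) : (m : ℂ) * ((a j : ℂ) ^ 2 + (c j : ℂ) ^ 2)
          = ∑ t ∈ Finset.Icc 1 m, ((a j : ℂ) ^ 2 + (c j : ℂ) ^ 2) := by
        rw [Finset.sum_const, Nat.card_Icc, nsmul_eq_mul, Nat.add_sub_cancel]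
      simp_rw [hconst, Finset.sum_mul, ← Finset.sum_add_distrib, Finset.mul_sum,
        ← Finset.sum_sub_distrib]
      rw [Finset.sum_comm (s := Finset.univ), ← Finset.sum_add_distrib]
      refine Finset.sum_congr rfl fun t _ => ?_
      rw [← Finset.sum_add_distrib]
      refine Finset.sum_congr rfl fun j _ => ?_
      linear_combination ((a j : ℂ) ^ 2 + (c j : ℂ) ^ 2) * Complex.I_sq
    rw [hsum]
    simp only [hQ, hR]
    push_cast
    rw [mul_add, mul_add, Finset.mul_sum (s := Finset.univ), Finset.mul_sum (s := Finset.univ),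
      Finset.sum_mul, ← Finset.sum_sub_distrib]
    congr 1
    refine Finset.sum_congr rfl fun j _ => ?_
    field_simp
    ring
  have hQ1 (m : ℕ) : 1 ≤ ‖Complex.exp (Q m : ℝ)‖ := by
    rw [Complex.norm_exp_ofReal]
    refine Real.one_le_exp ?_
    simp only [hQ]
    positivity
  have hDint (m : ℕ) : (∫ u in (0 : ℝ)..1, Complex.exp (((√(m : ℝ))⁻¹ : ℝ) *
      complexLacunaryPoly b (fun j t => (θc j t : ℂ)) (fun j t => (θs j t : ℂ)) m u))
      = ((∫ u, Real.exp ((√(m : ℝ))⁻¹ * lacunaryPoly b θc θs m u) ∂unifLaw : ℝ) : ℂ) := by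
    rw [integral_unifLaw, ← intervalIntegral.integral_ofReal]
    congr 1
    ext u
    rw [hpolyD]
    push_cast
    rfl
  -- The density of P_m and the oscillating factor merge into one exponential with coefficients θ +
  -- ia; the normalizing constant is the same integral at a = c = 0.
  have hratio (m : ℕ) : ∫ u, Complex.exp (((√(m : ℝ))⁻¹ *
        lacunaryPoly b (fun j _ => a j) (fun j _ => c j) m u : ℝ) * Complex.I)
        ∂(altLaw b θc θs m)
      = (∫ u in (0 : ℝ)..1, Complex.exp (((√(m : ℝ))⁻¹ : ℝ) * complexLacunaryPoly b
          (fun j t => (θc j t : ℂ) + a j * Complex.I)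
          (fun j t => (θs j t : ℂ) + c j * Complex.I) m u))
        / (∫ u in (0 : ℝ)..1, Complex.exp (((√(m : ℝ))⁻¹ : ℝ) *
          complexLacunaryPoly b (fun j t => (θc j t : ℂ)) (fun j t => (θs j t : ℂ)) m u)) := by
    rw [hDint, altLaw, integral_tilted, div_eq_inv_mul, ← intervalIntegral.integral_const_mul,
      ← integral_unifLaw]
    congr 1
    ext u
    rw [hpolyN, Complex.real_smul, mul_add, Complex.exp_add]
    push_cast
    ring_nf
  simp_rw [hratio]
  refine tendsto_div_of_sub_mul_tendsto_zero (Q := fun m => Complex.exp (Q m : ℝ)) ?_ ?_ hRlim hQ1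
  · refine hN.congr' ?_
    filter_upwards [eventually_gt_atTop 0] with m hm
    rw [hexpN hm, Complex.exp_add]
  · refine hD.congr fun m => ?_
    simp only [hQ]
    push_cast
    rfl

end LacunaryTest

/-! ### Convergence of the harmonic vector and of the test statistic. -/

theorem theorem2 (b : ℕ) [NeZero b] (hb : 2 ≤ b)
    (θc θs : Fin (b - 1) → ℕ → ℝ)
    (hbound : ∃ M : ℝ, ∀ m : ℕ, ∀ t ∈ Finset.Icc 1 m, ∀ j : Fin (b - 1),
      |θc j t| ≤ M ∧ |θs j t| ≤ M)
    (θcLim θsLim : Fin (b - 1) → ℝ)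
    (hc : ∀ j, Tendsto (fun m : ℕ => (m : ℝ)⁻¹ * ∑ t ∈ Finset.Icc 1 m, θc j t) atTop
      (𝓝 (θcLim j)))
    (hs : ∀ j, Tendsto (fun m : ℕ => (m : ℝ)⁻¹ * ∑ t ∈ Finset.Icc 1 m, θs j t) atTop
      (𝓝 (θsLim j)))
    (δ : Fin (b - 1) → ℂ)
    (hδ : ∀ j, δ j = (1 / 2 : ℂ) * ((θcLim j : ℂ) + Complex.I * (θsLim j : ℂ)))
    (l : ℝ) (hl : l = 2 * ∑ j, ‖δ j‖ ^ 2) :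
    TendstoInDistribution (fun m : ℕ => LacunaryTest.harmonicVector b m) atTop
        (id : (Fin (b - 1) → ℂ) → (Fin (b - 1) → ℂ))
        (fun m : ℕ => LacunaryTest.altLaw b θc θs m) (LacunaryTest.complexNormal δ) ∧
      TendstoInDistribution (fun m : ℕ => LacunaryTest.testStat b m) atTop
        (id : ℝ → ℝ)
        (fun m : ℕ => LacunaryTest.altLaw b θc θs m)
        (LacunaryTest.noncentralChiSq (2 * (b - 1)) l) ∧
      l = (1 / 2 : ℝ) * ∑ j, (θcLim j ^ 2 + θsLim j ^ 2) := by
  obtain ⟨M, hM⟩ := hbound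
  have hre (j : Fin (b - 1)) : (δ j).re = θcLim j / 2 := by
    rw [hδ]
    simp
    ring
  have him (j : Fin (b - 1)) : (δ j).im = θsLim j / 2 := by
    rw [hδ]
    simp
    ring
  have hmeas (m : ℕ) : Measurable fun u =>
      (WithLp.toLp 2 (LacunaryTest.harmonicVector b m u) : PiLp 2 fun _ : Fin (b - 1) => ℂ) := by
    have := LacunaryTest.measurable_harmonicVector b m
    fun_prop
  -- The characteristic function criterion needs an inner product, hence the detour through `PiLp
  -- 2`; the continuous map `WithLp.ofLp` then brings the limit back.
  have hLp : TendstoInDistribution (fun (m : ℕ) u =>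
      (WithLp.toLp 2 (LacunaryTest.harmonicVector b m u) : PiLp 2 fun _ : Fin (b - 1) => ℂ)) atTop
      (WithLp.toLp 2) (fun m : ℕ => LacunaryTest.altLaw b θc θs m)
      (LacunaryTest.complexNormal δ) := by
    refine ⟨fun m => (hmeas m).aemeasurable, by fun_prop,
      ProbabilityMeasure.tendsto_iff_tendsto_charFun.mpr fun t => ?_⟩
    simp only [ProbabilityMeasure.coe_mk]
    have h1 := (LacunaryTest.tendsto_charFun_sub_integral hb θc θs t).add
      (LacunaryTest.tendsto_integral_altLaw hb
        (fun j s hs => (hM s s (by simp [hs]) j).1) (fun j s hs => (hM s s (by simp [hs]) j).2)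
        hc hs (fun j => (t j).re) (fun j => (t j).im))
    simp only [sub_add_cancel, zero_add] at h1
    convert h1 using 2
    rw [LacunaryTest.charFun_complexNormal, PiLp.inner_apply, PiLp.norm_sq_eq_of_L2,
      Finset.sum_div]
    congr 5
    · ext j
      simp [Complex.inner, hre, him]
      ring
    · ext j
      rw [← Complex.normSq_eq_norm_sq, Complex.normSq_apply]
      ring
  have hvec : TendstoInDistribution (fun m : ℕ => LacunaryTest.harmonicVector b m) atTop
      (id : (Fin (b - 1) → ℂ) → (Fin (b - 1) → ℂ))
      (fun m : ℕ => LacunaryTest.altLaw b θc θs m) (LacunaryTest.complexNormal δ) :=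
    hLp.continuous_comp (g := WithLp.ofLp) (by fun_prop)
  refine ⟨hvec, ?_, ?_⟩
  · have hstat := hvec.continuous_comp (g := fun z => 2 * ∑ j, ‖z j‖ ^ 2) (by fun_prop)
    have hfun (m : ℕ) : (fun z : Fin (b - 1) → ℂ => 2 * ∑ j, ‖z j‖ ^ 2)
        ∘ LacunaryTest.harmonicVector b m = LacunaryTest.testStat b m := by
      ext u
      simp only [Function.comp, LacunaryTest.harmonicVector, LacunaryTest.testStat, norm_mul,
        mul_pow, Complex.norm_real, Real.norm_of_nonneg (Real.sqrt_nonneg _),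
        Real.sq_sqrt (Nat.cast_nonneg m), ← Finset.mul_sum]
      ring
    have hlaw : (LacunaryTest.complexNormal δ).map
        ((fun z : Fin (b - 1) → ℂ => 2 * ∑ j, ‖z j‖ ^ 2) ∘ id)
        -- The identification of the limit law needs b - 1 > 0, which is where b ≥ 2 enters.
        = (LacunaryTest.noncentralChiSq (2 * (b - 1)) l).map id := by
      rw [Measure.map_id, hl, ← LacunaryTest.complexNormal_map_norm_sq (by omega)]
      rfl
    simp_rw [hfun] at hstat
    refine ⟨hstat.forall_aemeasurable, aemeasurable_id, ?_⟩
    convert hstat.tendsto using 1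
    exact congrArg 𝓝 (Subtype.ext hlaw.symm)
  · rw [hl, Finset.mul_sum, Finset.mul_sum]
    refine Finset.sum_congr rfl fun j _ => ?_
    rw [← Complex.normSq_eq_norm_sq, Complex.normSq_apply, hre, him]
    ring
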